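/- Theorem. Let $d\in\{1,2,3\}$ and let $(W_n)_{n\ge 0}$ be the simple random walk on $\mathbb{Z}^d$ started at the origin: its steps are independent and each of them is equal to each of the $2d$ vectors $\pm e_1,\dots,\pm e_d$ with probability $\frac{1}{2d}$. For $n\ge 1$ let $V_n$ be a random variable whose law is obtained from the law of $W_n$ by the change of measure with factor $\exp\bigl(d\|W_n\|^2/2n\bigr)$, that is $$\mathbb{P}[V_n=w]=\frac{\mathrm{e}^{d\|w\|^2/2n}\;\mathbb{P}[W_n=w]}{\mathbb{E}\bigl[\mathrm{e}^{d\|W_n\|^2/2n}\bigr]},\qquad w\in\mathbb{Z}^d,$$ where $\|\cdot\|$ is the Euclidean norm. Define $\psi:\mathbb{R}^d\to(0,1]$ by $$\psi(x)=\exp\Bigl(-\frac{x^4}{12}\Bigr)\ (d=1),\qquad \psi(x_1,x_2)=\exp\Bigl(-\frac{x_1^4+x_2^4+6(x_1x_2)^2}{96}\Bigr)\ (d=2),$$ $$\psi(x_1,x_2,x_3)=\exp\Bigl(-\frac{(x_1x_2)^2+(x_1x_3)^2+(x_2x_3)^2}{36}\Bigr)\ (d=3).$$ Then $\psi$ is integrable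 on $\mathbb{R}^d$, and as $n\to\infty$ $$\frac{d\,V_n}{n^{3/4}}\ \rightharpoonup\ \frac{\psi(x)\,dx}{\int_{\mathbb{R}^d}\psi(y)\,dy}$$ in law. (Equivalently, $V_n/n^{3/4}$ converges in law to the probability distribution on $\mathbb{R}^d$ with density proportional to $x\mapsto\psi(d\,x)$.) -/

import Mathlib

open MeasureTheory ProbabilityTheory Filter

/-- The point of `ℝ^d` (with its Euclidean norm) given by a point of the lattice `ℤ^d`. -/
noncomputable def latticePoint (d : ℕ) (w : Fin d → ℤ) : EuclideanSpace ℝ (Fin d) :=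
  WithLp.toLp 2 (fun i => (w i : ℝ))

/-- `W` is a simple random walk on `ℤ^d` under `P`: it starts at the origin, its steps are
independent, and each step is equal to each of the `2d` vectors `± e_i` with probability
`1 / (2d)`. -/
structure IsSimpleRandomWalk {Ω : Type*} [MeasurableSpace Ω] (d : ℕ) (P : Measure Ω)
    (W : ℕ → Ω → Fin d → ℤ) : Prop where
  measurable : ∀ n, Measurable (W n)
  start : ∀ᵐ ω ∂P, W 0 ω = 0
  indep : iIndepFun (fun n ω => W (n + 1) ω - W n ω) P
  step_pos : ∀ (n : ℕ) (i : Fin d),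
    P {ω | W (n + 1) ω - W n ω = Pi.single i 1} = ((2 * d : ℕ) : ENNReal)⁻¹
  step_neg : ∀ (n : ℕ) (i : Fin d),
    P {ω | W (n + 1) ω - W n ω = -Pi.single i 1} = ((2 * d : ℕ) : ENNReal)⁻¹

/-- The change of measure: the law `ν` on `ℤ^d` is replaced by the probability measure
`exp (d ‖w‖² / (2 n)) ν(dw) / ∫ exp (d ‖w'‖² / (2 n)) ν(dw')`. -/
noncomputable def changedLaw (d n : ℕ) (ν : Measure (Fin d → ℤ)) : Measure (Fin d → ℤ) :=
  ν.tilted (fun w => (d : ℝ) * ‖latticePoint d w‖ ^ 2 / (2 * (n : ℝ)))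

/-- The limiting function `ψ` in dimensions `1`, `2` and `3`
(the value in the other dimensions is irrelevant). -/
noncomputable def limitPsi : (d : ℕ) → EuclideanSpace ℝ (Fin d) → ℝ
  | 1, x => Real.exp (-((x 0) ^ 4 / 12))
  | 2, x => Real.exp (-(((x 0) ^ 4 + (x 1) ^ 4 + 6 * (x 0 * x 1) ^ 2) / 96))
  | 3, x => Real.exp (-(((x 0 * x 1) ^ 2 + (x 0 * x 2) ^ 2 + (x 1 * x 2) ^ 2) / 36))
  | _, _ => 0

/-- The measure `ψ(x) dx / ∫ ψ(y) dy` on `ℝ^d`. -/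
noncomputable def limitLaw (d : ℕ) : Measure (EuclideanSpace ℝ (Fin d)) :=
  (volume : Measure (EuclideanSpace ℝ (Fin d))).withDensity
    (fun x => ENNReal.ofReal (limitPsi d x / ∫ y, limitPsi d y))

/-! The mechanism is Gaussian linearisation of the square (Hubbard–Stratonovich). With `r =
n^(1/4)`, adding to `d V_n / r^3` an independent centred Gaussian of covariance `(d / r^2) I` gives
a variable whose density is proportional to `normalizedMGF (x / r) ^ n`: the weight `exp (d ‖W_n‖² /
2n)` is a Gaussian average of the exponentials `exp (x · W_n / r)`, whose expectations are powers of
`stepMGF`. In terms of characteristic functions this is `integral_smoothedDensity_mul_cexp`. The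
added noise vanishes in the limit.

The quadratic terms cancel in `normalizedMGF`, so `normalizedMGF t - 1` is `-q(t)` up to higher
order; as `q` is homogeneous of degree 4 and `r^4 = n`, the densities tend pointwise to `exp (-q) =
ψ` (`tendsto_smoothedDensity`). An integrable majorant (`smoothedDensity_le`,
`integrable_limit_bound`) allows dominated convergence for the Fourier integrals, and Lévy's
continuity theorem concludes. -/

/-- The moment generating function of a step of the simple random walk on `ℤ^d`. -/
noncomputable def stepMGF (d : ℕ) (t : Fin d → ℝ) : ℝ := (∑ i, Real.cosh (t i)) / d

/-- The quartic form `q` with `ψ = exp (-q)`. -/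
noncomputable def quarticForm (d : ℕ) (t : Fin d → ℝ) : ℝ :=
  (∑ i, t i ^ 2) ^ 2 / (8 * (d : ℝ) ^ 2) - (∑ i, t i ^ 4) / (24 * d)

/-- The moment generating function of a step, normalised by the Gaussian one. -/
noncomputable def normalizedMGF (d : ℕ) (t : Fin d → ℝ) : ℝ :=
  stepMGF d t * Real.exp (-((∑ i, t i ^ 2) / (2 * d)))

/-- The density (up to a constant) of the smoothed and rescaled tilted walk at time `n`. -/
noncomputable def smoothedDensity (d n : ℕ) (x : Fin d → ℝ) : ℝ :=
  normalizedMGF d (fun i => x i / (n : ℝ) ^ (1 / 4 : ℝ)) ^ n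

/-! ### Taylor bounds for the moment generating function of a step. -/

/-- The case `k = 2` is exactly `d ≤ 3`, with equality at `d = 3`; this is where the restriction on
the dimension comes from. It compares the Taylor coefficients of the Gaussian and of `stepMGF`. -/
theorem two_mul_pow_mul_factorial_le {d : ℕ} (hd1 : 1 ≤ d) (hd3 : d ≤ 3) {k : ℕ} (hk : 2 ≤ k) :
    (2 * d) ^ k * k.factorial ≤ d * (2 * k).factorial := by
  induction k, hk using Nat.le_induction with
  | base => interval_cases d <;> decide
  | succ k hk ih =>
    have e : 2 * (k + 1) = 2 * k + 1 + 1 := by ring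
    rw [e, Nat.factorial_succ, Nat.factorial_succ, Nat.factorial_succ, pow_succ]
    have h : 2 * d * (k + 1) ≤ (2 * k + 1 + 1) * (2 * k + 1) := by nlinarith
    calc (2 * d) ^ k * (2 * d) * ((k + 1) * k.factorial)
        = ((2 * d) ^ k * k.factorial) * (2 * d * (k + 1)) := by ring
      _ ≤ (d * (2 * k).factorial) * ((2 * k + 1 + 1) * (2 * k + 1)) := Nat.mul_le_mul ih h
      _ = _ := by ring

theorem sum_pow_le_sum_pow {ι : Type*} (s : Finset ι) {a : ι → ℝ} (ha : ∀ i, 0 ≤ a i) {k : ℕ}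
    (hk : 1 ≤ k) : ∑ i ∈ s, a i ^ k ≤ (∑ i ∈ s, a i) ^ k := by
  obtain ⟨k, rfl⟩ := Nat.exists_eq_add_of_le' hk
  rw [pow_succ, Finset.mul_sum]
  refine Finset.sum_le_sum fun i hi => ?_
  rw [pow_succ]
  exact mul_le_mul_of_nonneg_right
    (pow_le_pow_left₀ (ha i) (Finset.single_le_sum (fun j _ => ha j) hi) _) (ha i)

theorem stepMGF_nonneg (d : ℕ) (t : Fin d → ℝ) : 0 ≤ stepMGF d t :=
  div_nonneg (Finset.sum_nonneg fun _ _ => (Real.cosh_pos _).le) (Nat.cast_nonneg _)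

theorem normalizedMGF_nonneg (d : ℕ) (t : Fin d → ℝ) : 0 ≤ normalizedMGF d t :=
  mul_nonneg (stepMGF_nonneg d t) (Real.exp_pos _).le

theorem hasSum_stepMGF (d : ℕ) (t : Fin d → ℝ) :
    HasSum (fun k : ℕ => (∑ i, (t i ^ 2) ^ k) / (d * (2 * k).factorial)) (stepMGF d t) := by
  have h := (hasSum_sum (s := Finset.univ) fun i _ => Real.hasSum_cosh (t i)).div_const (d : ℝ)
  refine h.congr_fun fun k => ?_
  rw [← Finset.sum_div, div_div, mul_comm (d : ℝ)]
  simp_rw [pow_mul]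

theorem hasSum_exp_div (u : ℝ) : HasSum (fun k : ℕ => u ^ k / k.factorial) (Real.exp u) := by
  rw [Real.exp_eq_exp_ℝ]
  exact NormedSpace.expSeries_div_hasSum_exp u

/-- In the difference of the two power series, orders 0 and 1 cancel, order 2 is `q`, and all later
terms are nonnegative by the coefficient comparison. -/
theorem stepMGF_le_exp_sub_quarticForm {d : ℕ} (hd1 : 1 ≤ d) (hd3 : d ≤ 3) (t : Fin d → ℝ) :
    stepMGF d t ≤ Real.exp ((∑ i, t i ^ 2) / (2 * d)) - quarticForm d t := by
  have hd : (0 : ℝ) < d := by exact_mod_cast hd1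
  have h := (hasSum_exp_div ((∑ i, t i ^ 2) / (2 * d))).sub (hasSum_stepMGF d t)
  have h3 := sum_le_hasSum (Finset.range 3) (fun k hk => ?_) h
  · have e : ∑ k ∈ Finset.range 3, (((∑ i, t i ^ 2) / (2 * d)) ^ k / (k.factorial : ℝ) -
        (∑ i, (t i ^ 2) ^ k) / (d * (2 * k).factorial)) = quarticForm d t := by
      simp only [Finset.sum_range_succ, Finset.sum_range_zero, quarticForm, ← pow_mul]
      norm_num [Nat.factorial]
      field_simp
      ring
    rw [e] at h3
    linarith
  · simp only [Finset.mem_range, not_lt] at hk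
    rw [sub_nonneg, div_pow, div_div]
    have hf := two_mul_pow_mul_factorial_le hd1 hd3 (k := k) (by omega)
    refine div_le_div₀ (pow_nonneg (Finset.sum_nonneg fun i _ => sq_nonneg _) _)
      (sum_pow_le_sum_pow _ (fun _ => sq_nonneg _) (by omega)) (by positivity) ?_
    exact_mod_cast hf

theorem le_stepMGF {d : ℕ} (hd1 : 1 ≤ d) (t : Fin d → ℝ) :
    1 + (∑ i, t i ^ 2) / (2 * d) + (∑ i, t i ^ 4) / (24 * d) ≤ stepMGF d t := by
  have hd : (0 : ℝ) < d := by exact_mod_cast hd1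
  have h3 := sum_le_hasSum (Finset.range 3) (fun k _ => ?_) (hasSum_stepMGF d t)
  · refine le_trans (le_of_eq ?_) h3
    simp only [Finset.sum_range_succ, Finset.sum_range_zero, ← pow_mul]
    norm_num [Nat.factorial]
    field_simp
  · exact div_nonneg (Finset.sum_nonneg fun i _ => by positivity) (by positivity)

theorem normalizedMGF_sub_one_le {d : ℕ} (hd1 : 1 ≤ d) (hd3 : d ≤ 3) (t : Fin d → ℝ) :
    normalizedMGF d t - 1 ≤ -(quarticForm d t * Real.exp (-((∑ i, t i ^ 2) / (2 * d)))) := by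
  have h := mul_le_mul_of_nonneg_right (stepMGF_le_exp_sub_quarticForm hd1 hd3 t)
    (Real.exp_pos (-((∑ i, t i ^ 2) / (2 * d)))).le
  rw [sub_mul, ← Real.exp_add, add_neg_cancel, Real.exp_zero] at h
  rw [normalizedMGF]
  linarith

theorem exp_le_cubic {u : ℝ} (h0 : 0 ≤ u) (h1 : u ≤ 1) :
    Real.exp u ≤ 1 + u + u ^ 2 / 2 + u ^ 3 := by
  have h := Real.exp_bound' h0 h1 (n := 3) (by norm_num)
  norm_num [Finset.sum_range_succ, Nat.factorial] at h
  nlinarith [pow_nonneg h0 3]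

/-- Matching lower bound near the origin: the cubic error becomes negligible after rescaling. -/
theorem le_normalizedMGF_sub_one {d : ℕ} (hd1 : 1 ≤ d) (t : Fin d → ℝ)
    (ht : (∑ i, t i ^ 2) / (2 * d) ≤ 1) :
    -((quarticForm d t + ((∑ i, t i ^ 2) / (2 * d)) ^ 3) *
      Real.exp (-((∑ i, t i ^ 2) / (2 * d)))) ≤ normalizedMGF d t - 1 := by
  have hd : (0 : ℝ) < d := by exact_mod_cast hd1
  have hu : 0 ≤ (∑ i, t i ^ 2) / (2 * d) :=
    div_nonneg (Finset.sum_nonneg fun i _ => sq_nonneg _) (by positivity)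
  have h1 := exp_le_cubic hu ht
  have h2 := le_stepMGF hd1 t
  have e : quarticForm d t = ((∑ i, t i ^ 2) / (2 * d)) ^ 2 / 2 - (∑ i, t i ^ 4) / (24 * d) := by
    rw [quarticForm]; field_simp; ring
  have h := mul_le_mul_of_nonneg_right
    (show Real.exp ((∑ i, t i ^ 2) / (2 * d)) - (quarticForm d t +
      ((∑ i, t i ^ 2) / (2 * d)) ^ 3) ≤ stepMGF d t by rw [e]; linarith)
    (Real.exp_pos (-((∑ i, t i ^ 2) / (2 * d)))).le
  rw [sub_mul, ← Real.exp_add, add_neg_cancel, Real.exp_zero] at h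
  rw [normalizedMGF]
  linarith

/-! ### Rescaling by `n^(1/4)` and the pointwise limit of the densities. -/

theorem sum_sq_div {d : ℕ} (x : Fin d → ℝ) (r : ℝ) :
    ∑ i, (x i / r) ^ 2 = (∑ i, x i ^ 2) / r ^ 2 := by
  simp only [div_pow, Finset.sum_div]

theorem quarticForm_div {d : ℕ} (x : Fin d → ℝ) (r : ℝ) :
    quarticForm d (fun i => x i / r) = quarticForm d x / r ^ 4 := by
  simp only [quarticForm, sum_sq_div, div_pow _ _ 4, ← Finset.sum_div]
  ring

theorem tendsto_rpow_quarter : Tendsto (fun n : ℕ => (n : ℝ) ^ (1 / 4 : ℝ)) atTop atTop :=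
  (tendsto_rpow_atTop (by norm_num)).comp tendsto_natCast_atTop_atTop

theorem rpow_quarter_pow_four (n : ℕ) : ((n : ℝ) ^ (1 / 4 : ℝ)) ^ 4 = n := by
  rw [← Real.rpow_natCast, ← Real.rpow_mul (Nat.cast_nonneg n)]
  norm_num

theorem one_le_rpow_quarter {n : ℕ} (hn : 1 ≤ n) : 1 ≤ (n : ℝ) ^ (1 / 4 : ℝ) :=
  Real.one_le_rpow (by exact_mod_cast hn) (by norm_num)

theorem tendsto_smoothedDensity {d : ℕ} (hd1 : 1 ≤ d) (hd3 : d ≤ 3) (x : Fin d → ℝ) :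
    Tendsto (fun n => smoothedDensity d n x) atTop (nhds (Real.exp (-quarticForm d x))) := by
  set p := ∑ i, x i ^ 2 with hp
  have hsq : Tendsto (fun n : ℕ => p / ((n : ℝ) ^ (1 / 4 : ℝ)) ^ 2 / (2 * d)) atTop (nhds 0) := by
    have := (tendsto_const_nhds (x := p)).div_atTop
      ((tendsto_pow_atTop two_ne_zero).comp tendsto_rpow_quarter)
    simpa using this.div_const (2 * (d : ℝ))
  have hexp : Tendsto (fun n : ℕ => Real.exp (-(p / ((n : ℝ) ^ (1 / 4 : ℝ)) ^ 2 / (2 * d))))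
      atTop (nhds 1) := by
    have := (Real.continuous_exp.tendsto _).comp hsq.neg
    rwa [neg_zero, Real.exp_zero] at this
  have key : Tendsto (fun n : ℕ => (n : ℝ) *
      (normalizedMGF d (fun i => x i / (n : ℝ) ^ (1 / 4 : ℝ)) - 1)) atTop
      (nhds (-quarticForm d x)) := by
    -- Multiplying by `n = r^4` turns the cubic error, of order `r^(-6)`, into one of order
    -- `r^(-2)`.
    have hlow : Tendsto (fun n : ℕ => -((quarticForm d x + (p / (2 * d)) ^ 3 /
        ((n : ℝ) ^ (1 / 4 : ℝ)) ^ 2) *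
        Real.exp (-(p / ((n : ℝ) ^ (1 / 4 : ℝ)) ^ 2 / (2 * d))))) atTop
        (nhds (-quarticForm d x)) := by
      have h1 := (tendsto_const_nhds (x := (p / (2 * d)) ^ 3)).div_atTop
        ((tendsto_pow_atTop two_ne_zero).comp tendsto_rpow_quarter)
      simpa using (((tendsto_const_nhds (x := quarticForm d x)).add h1).mul hexp).neg
    have hup : Tendsto (fun n : ℕ => -(quarticForm d x *
        Real.exp (-(p / ((n : ℝ) ^ (1 / 4 : ℝ)) ^ 2 / (2 * d))))) atTop
        (nhds (-quarticForm d x)) := by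
      simpa using (hexp.const_mul (quarticForm d x)).neg
    refine tendsto_of_tendsto_of_tendsto_of_le_of_le' hlow hup ?_ ?_
    · filter_upwards [eventually_ge_atTop 1, hsq.eventually (ge_mem_nhds one_pos)] with n hn hn1
      have h := le_normalizedMGF_sub_one hd1 (fun i => x i / (n : ℝ) ^ (1 / 4 : ℝ))
        (by rw [sum_sq_div]; exact hn1)
      rw [sum_sq_div, quarticForm_div, ← hp] at h
      have hr := one_le_rpow_quarter hn
      have hr4 := rpow_quarter_pow_four n
      set r := (n : ℝ) ^ (1 / 4 : ℝ)
      have h' := mul_le_mul_of_nonneg_left h (Nat.cast_nonneg (α := ℝ) n)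
      refine le_trans (le_of_eq ?_) h'
      rw [← hr4]
      field_simp
    · filter_upwards [eventually_ge_atTop 1] with n hn
      have h := normalizedMGF_sub_one_le hd1 hd3 (fun i => x i / (n : ℝ) ^ (1 / 4 : ℝ))
      rw [sum_sq_div, quarticForm_div, ← hp] at h
      have hr := one_le_rpow_quarter hn
      have hr4 := rpow_quarter_pow_four n
      set r := (n : ℝ) ^ (1 / 4 : ℝ)
      have h' := mul_le_mul_of_nonneg_left h (Nat.cast_nonneg (α := ℝ) n)
      refine le_trans h' (le_of_eq ?_)
      rw [← hr4]
      field_simp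
  have := Real.tendsto_one_add_pow_exp_of_tendsto key
  simpa [smoothedDensity] using this

/-! ### A majorant uniform in `n`. -/

theorem cosh_le_exp_abs (x : ℝ) : Real.cosh x ≤ Real.exp |x| := by
  rw [← Real.cosh_abs, Real.cosh_eq]
  have : Real.exp (-|x|) ≤ Real.exp |x| := Real.exp_le_exp.2 (by linarith [abs_nonneg x])
  linarith

theorem stepMGF_le_exp_sqrt {d : ℕ} (hd1 : 1 ≤ d) (t : Fin d → ℝ) :
    stepMGF d t ≤ Real.exp √(∑ i, t i ^ 2) := by
  have hd : (0 : ℝ) < d := by exact_mod_cast hd1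
  rw [stepMGF, div_le_iff₀ hd]
  calc ∑ i, Real.cosh (t i) ≤ ∑ _i : Fin d, Real.exp √(∑ i, t i ^ 2) := by
        refine Finset.sum_le_sum fun i _ => (cosh_le_exp_abs _).trans (Real.exp_le_exp.2 ?_)
        exact Real.abs_le_sqrt
          (Finset.single_le_sum (f := fun i => t i ^ 2) (fun j _ => sq_nonneg _) (Finset.mem_univ i))
    _ = _ := by simp [mul_comm]

theorem normalizedMGF_le {d : ℕ} (hd1 : 1 ≤ d) (hd3 : d ≤ 3) (t : Fin d → ℝ)
    (hq : 0 ≤ quarticForm d t) :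
    normalizedMGF d t ≤ Real.exp (-(Real.exp (-(8 * d)) * quarticForm d t)) ∨
      normalizedMGF d t ≤ Real.exp (-((∑ i, t i ^ 2) / (4 * d))) := by
  have hd : (0 : ℝ) < d := by exact_mod_cast hd1
  set s := √(∑ i, t i ^ 2) with hs
  have hs2 : ∑ i, t i ^ 2 = s ^ 2 :=
    (Real.sq_sqrt (Finset.sum_nonneg fun i _ => sq_nonneg _)).symm
  have hs0 : 0 ≤ s := Real.sqrt_nonneg _
  -- Below `4d` the Gaussian factor is at least `exp (-8d)`; above it, `s ≤ s² / (4d)`, so half of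
  -- the Gaussian exponent absorbs the growth `exp s` of `stepMGF`.
  rcases le_total s (4 * d) with h | h
  · left
    have h1 := normalizedMGF_sub_one_le hd1 hd3 t
    have h2 : Real.exp (-(8 * d)) ≤ Real.exp (-((∑ i, t i ^ 2) / (2 * d))) := by
      rw [Real.exp_le_exp, neg_le_neg_iff, div_le_iff₀ (by positivity), hs2]
      nlinarith
    have h3 := Real.add_one_le_exp (-(Real.exp (-(8 * d)) * quarticForm d t))
    nlinarith [mul_le_mul_of_nonneg_left h2 hq]
  · right
    refine (mul_le_mul_of_nonneg_right (stepMGF_le_exp_sqrt hd1 t) (Real.exp_pos _).le).trans ?_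
    rw [← Real.exp_add, Real.exp_le_exp, ← hs, hs2]
    have : s ≤ s ^ 2 / (4 * d) := by
      rw [le_div_iff₀ (by positivity)]; nlinarith
    have e : s ^ 2 / (2 * d) = s ^ 2 / (4 * d) + s ^ 2 / (4 * d) := by ring
    linarith

theorem smoothedDensity_nonneg (d n : ℕ) (x : Fin d → ℝ) : 0 ≤ smoothedDensity d n x :=
  pow_nonneg (normalizedMGF_nonneg d _) n

/-- Under the `n`-th power the quartic bound is scale invariant, while the Gaussian exponent gains a
factor `r^2 ≥ 1` that can be dropped. -/
theorem smoothedDensity_le {d n : ℕ} (hd1 : 1 ≤ d) (hd3 : d ≤ 3) (hn : 1 ≤ n) (x : Fin d → ℝ)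
    (hq : 0 ≤ quarticForm d x) :
    smoothedDensity d n x ≤ Real.exp (-(Real.exp (-(8 * d)) * quarticForm d x)) +
      Real.exp (-((∑ i, x i ^ 2) / (4 * d))) := by
  have hd : (0 : ℝ) < d := by exact_mod_cast hd1
  have hr := one_le_rpow_quarter hn
  have hr4 := rpow_quarter_pow_four n
  set r := (n : ℝ) ^ (1 / 4 : ℝ) with hrdef
  have hp : 0 ≤ ∑ i, x i ^ 2 := Finset.sum_nonneg fun i _ => sq_nonneg _
  rcases normalizedMGF_le hd1 hd3 (fun i => x i / r)
    (by rw [quarticForm_div]; positivity) with h | h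
  · refine le_add_of_le_of_nonneg ?_ (Real.exp_pos _).le
    refine (pow_le_pow_left₀ (normalizedMGF_nonneg d _) h n).trans (le_of_eq ?_)
    rw [← Real.exp_nat_mul, quarticForm_div, ← hr4]
    congr 1
    field_simp
  · refine le_add_of_nonneg_of_le (Real.exp_pos _).le ?_
    refine (pow_le_pow_left₀ (normalizedMGF_nonneg d _) h n).trans ?_
    rw [← Real.exp_nat_mul, sum_sq_div, ← hr4, Real.exp_le_exp]
    have e : r ^ 4 * -((∑ i, x i ^ 2) / r ^ 2 / (4 * d)) =
      -(r ^ 2 * ((∑ i, x i ^ 2) / (4 * d))) := by field_simp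
    rw [e, neg_le_neg_iff]
    exact le_mul_of_one_le_left (by positivity) (one_le_pow₀ hr)

/-! ### Integrability of `exp (-c q)`. -/

theorem exp_neg_mul_sum_sq {d : ℕ} (b : ℝ) (x : Fin d → ℝ) :
    Real.exp (-(b * ∑ i, x i ^ 2)) = ∏ i, Real.exp (-b * x i ^ 2) := by
  rw [← Real.exp_sum, Finset.mul_sum, ← Finset.sum_neg_distrib]
  simp only [neg_mul]

theorem integrable_exp_neg_mul_sum_sq {d : ℕ} {b : ℝ} (hb : 0 < b) :
    Integrable (fun x : Fin d → ℝ => Real.exp (-(b * ∑ i, x i ^ 2))) := by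
  simp only [exp_neg_mul_sum_sq]
  exact Integrable.fintype_prod (f := fun (_ : Fin d) (x : ℝ) => Real.exp (-b * x ^ 2))
    fun _ => integrable_exp_neg_mul_sq hb

theorem integral_exp_neg_mul_sum_sq_fin_two {b : ℝ} (hb : 0 < b) :
    ∫ x : Fin 2 → ℝ, Real.exp (-(b * ∑ i, x i ^ 2)) = Real.pi / b := by
  simp only [exp_neg_mul_sum_sq]
  rw [integral_fintype_prod_volume_eq_prod (f := fun (_ : Fin 2) (x : ℝ) => Real.exp (-b * x ^ 2))]
  simp only [integral_gaussian, Fin.prod_univ_two]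
  exact Real.mul_self_sqrt (by positivity)

/-- Integrating out the two other coordinates leaves `π / (a (1 + x_i²))`, which is integrable. This
serves `d = 3`, where `q` vanishes on the coordinate axes and no radial majorant can work. -/
theorem integrable_exp_neg_mul_one_add_sq_mul {a : ℝ} (ha : 0 < a) (i : Fin 3) :
    Integrable (fun x : Fin 3 → ℝ =>
      Real.exp (-(a * (1 + x i ^ 2) * ∑ j, x (i.succAbove j) ^ 2))) := by
  have h : Integrable (fun y : ℝ × (Fin 2 → ℝ) =>
      Real.exp (-(a * (1 + y.1 ^ 2) * ∑ j, y.2 j ^ 2))) (volume.prod volume) := by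
    rw [integrable_prod_iff (by fun_prop)]
    refine ⟨ae_of_all _ fun y =>
      integrable_exp_neg_mul_sum_sq (b := a * (1 + y ^ 2)) (by positivity), ?_⟩
    simp only [Real.norm_eq_abs, Real.abs_exp]
    have e : ∀ y : ℝ, ∫ z : Fin 2 → ℝ, Real.exp (-(a * (1 + y ^ 2) * ∑ j, z j ^ 2)) =
        Real.pi / a * (1 + y ^ 2)⁻¹ := fun y => by
      rw [integral_exp_neg_mul_sum_sq_fin_two (by positivity)]
      field_simp
    simp only [e]
    exact integrable_inv_one_add_sq.const_mul _
  exact ((volume_preserving_piFinSuccAbove (fun _ : Fin 3 => ℝ) i).integrable_comp_emb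
    (MeasurableEquiv.measurableEmbedding _)).2 h

theorem quarticForm_one (x : Fin 1 → ℝ) : quarticForm 1 x = x 0 ^ 4 / 12 := by
  simp [quarticForm]; ring

theorem quarticForm_two (x : Fin 2 → ℝ) :
    quarticForm 2 x = (x 0 ^ 4 + x 1 ^ 4 + 6 * (x 0 * x 1) ^ 2) / 96 := by
  simp [quarticForm, Fin.sum_univ_two]; ring

theorem quarticForm_three (x : Fin 3 → ℝ) :
    quarticForm 3 x = ((x 0 * x 1) ^ 2 + (x 0 * x 2) ^ 2 + (x 1 * x 2) ^ 2) / 36 := by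
  simp [quarticForm, Fin.sum_univ_three]; ring

theorem quarticForm_nonneg {d : ℕ} (hd1 : 1 ≤ d) (hd3 : d ≤ 3) (x : Fin d → ℝ) :
    0 ≤ quarticForm d x := by
  interval_cases d
  · rw [quarticForm_one]; positivity
  · rw [quarticForm_two]; positivity
  · rw [quarticForm_three]; positivity

theorem measurable_quarticForm (d : ℕ) : Measurable (quarticForm d) := by
  unfold quarticForm; fun_prop

/-- If `u` is the largest of three nonnegative numbers, the second elementary symmetric function
controls `(1 + u) * (v + w)`. -/
theorem one_add_mul_add_le {u v w : ℝ} (hv : 0 ≤ v) (hw : 0 ≤ w) (h1 : v ≤ u) (h2 : w ≤ u) :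
    (1 + u) * (v + w) ≤ 1 + 2 * (u * v + u * w + v * w) := by
  nlinarith [sq_nonneg (v + w - 2), mul_nonneg hv hw, sq_nonneg (v + w - 1),
    mul_nonneg (sub_nonneg.2 h1) hv, mul_nonneg (sub_nonneg.2 h1) hw,
    mul_nonneg (sub_nonneg.2 h2) hw, mul_nonneg (sub_nonneg.2 h2) hv]

theorem integrable_exp_neg_mul_quarticForm {d : ℕ} (hd1 : 1 ≤ d) (hd3 : d ≤ 3) {c : ℝ}
    (hc : 0 < c) : Integrable (fun x : Fin d → ℝ => Real.exp (-(c * quarticForm d x))) := by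
  have hm : AEStronglyMeasurable (fun x : Fin d → ℝ => Real.exp (-(c * quarticForm d x))) volume :=
    ((measurable_quarticForm d).const_mul c).neg.exp.aestronglyMeasurable
  interval_cases d
  · refine ((integrable_exp_neg_mul_sum_sq (b := c / 6) (by positivity)).const_mul
      (Real.exp (c / 12))).mono' hm (ae_of_all _ fun x => ?_)
    rw [Real.norm_eq_abs, Real.abs_exp, ← Real.exp_add, Real.exp_le_exp, quarticForm_one,
      Fin.sum_univ_one]
    -- From `x^4 ≥ 2 x^2 - 1`, which fixes the constants `c / 6` and `c / 12`; the case `d = 2` is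
    -- analogous.
    nlinarith [mul_nonneg hc.le (sq_nonneg (x 0 ^ 2 - 1))]
  · refine ((integrable_exp_neg_mul_sum_sq (b := c / 48) (by positivity)).const_mul
      (Real.exp (c / 48))).mono' hm (ae_of_all _ fun x => ?_)
    rw [Real.norm_eq_abs, Real.abs_exp, ← Real.exp_add, Real.exp_le_exp, quarticForm_two,
      Fin.sum_univ_two]
    nlinarith [mul_nonneg hc.le (sq_nonneg (x 0 ^ 2 - 1)),
      mul_nonneg hc.le (sq_nonneg (x 1 ^ 2 - 1)), mul_nonneg hc.le (sq_nonneg (x 0 * x 1))]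
  · refine (((integrable_finsetSum Finset.univ fun i _ =>
      integrable_exp_neg_mul_one_add_sq_mul (a := c / 72) (by positivity) i)).const_mul
      (Real.exp (c / 72))).mono' hm (ae_of_all _ fun x => ?_)
    rw [Real.norm_eq_abs, Real.abs_exp]
    -- The index of the largest coordinate depends on `x`, hence the majorant sums over all three.
    obtain ⟨i, hi⟩ := Finite.exists_max fun i => x i ^ 2
    refine le_trans ?_ (mul_le_mul_of_nonneg_left (Finset.single_le_sum
      (f := fun i : Fin 3 => Real.exp (-(c / 72 * (1 + x i ^ 2) * ∑ j, x (i.succAbove j) ^ 2)))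
      (fun j _ => (Real.exp_pos _).le) (Finset.mem_univ i)) (Real.exp_pos _).le)
    rw [← Real.exp_add, Real.exp_le_exp]
    have key := mul_le_mul_of_nonneg_left (one_add_mul_add_le (sq_nonneg (x (i.succAbove 0)))
      (sq_nonneg (x (i.succAbove 1))) (hi (i.succAbove 0)) (hi (i.succAbove 1))) hc.le
    have e : quarticForm 3 x = (x i ^ 2 * x (i.succAbove 0) ^ 2 +
        x i ^ 2 * x (i.succAbove 1) ^ 2 + x (i.succAbove 0) ^ 2 * x (i.succAbove 1) ^ 2) / 36 := by
      rw [quarticForm_three]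
      fin_cases i <;> simp [Fin.succAbove] <;> ring
    rw [e, Fin.sum_univ_two]
    linarith

theorem integrable_limit_bound {d : ℕ} (hd1 : 1 ≤ d) (hd3 : d ≤ 3) :
    Integrable (fun x : Fin d → ℝ => Real.exp (-(Real.exp (-(8 * d)) * quarticForm d x)) +
      Real.exp (-((∑ i, x i ^ 2) / (4 * d)))) := by
  have hd : (0 : ℝ) < d := by exact_mod_cast hd1
  refine (integrable_exp_neg_mul_quarticForm hd1 hd3 (Real.exp_pos _)).add ?_
  have h := integrable_exp_neg_mul_sum_sq (d := d) (b := 1 / (4 * d)) (by positivity)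
  simpa only [one_div_mul_eq_div] using h

/-! ### Convergence of the Fourier integrals. -/

theorem measurable_smoothedDensity (d n : ℕ) : Measurable (smoothedDensity d n) := by
  unfold smoothedDensity normalizedMGF stepMGF
  fun_prop

theorem integrable_smoothedDensity {d n : ℕ} (hd1 : 1 ≤ d) (hd3 : d ≤ 3) (hn : 1 ≤ n) :
    Integrable (smoothedDensity d n) := by
  refine (integrable_limit_bound hd1 hd3).mono' (measurable_smoothedDensity d n).aestronglyMeasurable
    (ae_of_all _ fun x => ?_)
  rw [Real.norm_of_nonneg (smoothedDensity_nonneg d n x)]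
  exact smoothedDensity_le hd1 hd3 hn x (quarticForm_nonneg hd1 hd3 x)

theorem tendsto_integral_smoothedDensity_mul_cexp {d : ℕ} (hd1 : 1 ≤ d) (hd3 : d ≤ 3)
    (s : Fin d → ℝ) :
    Tendsto (fun n : ℕ => ∫ x : Fin d → ℝ,
        (smoothedDensity d n x : ℂ) * Complex.exp ((∑ i, x i * s i : ℝ) * Complex.I))
      atTop (nhds (∫ x : Fin d → ℝ,
        (Real.exp (-quarticForm d x) : ℂ) * Complex.exp ((∑ i, x i * s i : ℝ) * Complex.I))) := by
  refine tendsto_integral_filter_of_dominated_convergence _ ?_ ?_ (integrable_limit_bound hd1 hd3)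
    (ae_of_all _ fun x => ?_)
  · refine Eventually.of_forall fun n => Measurable.aestronglyMeasurable ?_
    have := measurable_smoothedDensity d n
    fun_prop
  · filter_upwards [eventually_ge_atTop 1] with n hn
    refine ae_of_all _ fun x => ?_
    rw [norm_mul, Complex.norm_exp_ofReal_mul_I, mul_one, Complex.norm_real,
      Real.norm_of_nonneg (smoothedDensity_nonneg d n x)]
    exact smoothedDensity_le hd1 hd3 hn x (quarticForm_nonneg hd1 hd3 x)
  · exact ((Complex.continuous_ofReal.tendsto _).comp
      (tendsto_smoothedDensity hd1 hd3 x)).mul_const _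

/-! ### Law of a step and exponential moments of the walk. -/

/-- The `2d` possible steps of the simple random walk on `ℤ^d`. -/
def walkStep (d : ℕ) (p : Fin d × Bool) : Fin d → ℤ :=
  if p.2 then Pi.single p.1 1 else -Pi.single p.1 1

theorem walkStep_injective (d : ℕ) : Function.Injective (walkStep d) := by
  rintro ⟨i, b⟩ ⟨j, c⟩ h
  have hi := congrFun h i
  have hij : i = j := by
    by_contra hne
    cases b <;> cases c <;> simp [walkStep, hne] at hi
  subst hij
  cases b <;> cases c <;> simp [walkStep] at hi ⊢

theorem integral_comp_of_uniform_walkStep {Ω : Type*} [MeasurableSpace Ω] {d : ℕ} (hd1 : 1 ≤ d)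
    {P : Measure Ω} [IsProbabilityMeasure P] {ξ : Ω → Fin d → ℤ} (hξ : Measurable ξ)
    (hpos : ∀ i, P {ω | ξ ω = Pi.single i 1} = ((2 * d : ℕ) : ENNReal)⁻¹)
    (hneg : ∀ i, P {ω | ξ ω = -Pi.single i 1} = ((2 * d : ℕ) : ENNReal)⁻¹)
    (F : (Fin d → ℤ) → ℝ) :
    ∫ ω, F (ξ ω) ∂P = (∑ i, (F (Pi.single i 1) + F (-Pi.single i 1))) / (2 * d) := by
  classical
  have hprob : IsProbabilityMeasure (P.map ξ) := Measure.isProbabilityMeasure_map hξ.aemeasurable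
  have hv : ∀ p, P.map ξ {walkStep d p} = ((2 * d : ℕ) : ENNReal)⁻¹ := by
    rintro ⟨i, b⟩
    rw [Measure.map_apply hξ (measurableSet_singleton _)]
    cases b
    · exact hneg i
    · exact hpos i
  -- The `2d` distinct atoms already exhaust the mass, so the step takes no other value almost
  -- surely.
  have hS : P.map ξ (Finset.univ.image (walkStep d) : Finset (Fin d → ℤ)) = 1 := by
    rw [← sum_measure_singleton, Finset.sum_image (walkStep_injective d).injOn,
      Finset.sum_congr rfl fun p _ => hv p, Finset.sum_const, Finset.card_univ, Fintype.card_prod,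
      Fintype.card_fin, Fintype.card_bool, nsmul_eq_mul, mul_comm d 2]
    exact ENNReal.mul_inv_cancel (by positivity) (ENNReal.natCast_ne_top _)
  have hae : ∀ᵐ w ∂(P.map ξ), w ∈ (Finset.univ.image (walkStep d) : Finset (Fin d → ℤ)) :=
    (prob_compl_eq_zero_iff (Finset.measurableSet _)).2 hS
  rw [← integral_map (φ := ξ) hξ.aemeasurable (measurable_of_countable F).aestronglyMeasurable,
    ← Measure.restrict_eq_self_of_ae_mem hae, setIntegral_finset _ IntegrableOn.finset,
    Finset.sum_image (walkStep_injective d).injOn, Fintype.sum_prod_type, Finset.sum_div]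
  refine Finset.sum_congr rfl fun i _ => ?_
  simp only [Measure.real, hv, Fintype.sum_bool]
  simp [walkStep]
  ring

section Walk

variable {Ω : Type*} [MeasurableSpace Ω] {d : ℕ} {P : Measure Ω} [IsProbabilityMeasure P]
  {W : ℕ → Ω → Fin d → ℤ}

theorem IsSimpleRandomWalk.integral_exp (hW : IsSimpleRandomWalk d P W) (hd1 : 1 ≤ d) (n : ℕ)
    (t : Fin d → ℝ) : ∫ ω, Real.exp (∑ i, t i * W n ω i) ∂P = stepMGF d t ^ n := by
  set L : (Fin d → ℤ) → ℝ := fun w => ∑ i, t i * w i with hL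
  have hLm : Measurable L := measurable_of_countable L
  have hstep : ∀ k, Measurable fun ω => W (k + 1) ω - W k ω := fun k =>
    (hW.measurable (k + 1)).sub (hW.measurable k)
  have hind : iIndepFun (fun k ω => L (W (k + 1) ω - W k ω)) P :=
    hW.indep.comp (fun _ => L) fun _ => hLm
  have hmgf : ∀ k, mgf (fun ω => L (W (k + 1) ω - W k ω)) P 1 = stepMGF d t := fun k => by
    have h := integral_comp_of_uniform_walkStep hd1 (hstep k) (hW.step_pos k) (hW.step_neg k)
      fun w => Real.exp (L w)
    simp only [mgf, one_mul]
    rw [h, stepMGF, mul_comm (2 : ℝ), ← div_div, div_right_comm, Finset.sum_div]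
    congr 1
    refine Finset.sum_congr rfl fun i _ => ?_
    simp [Real.cosh_eq, hL, Pi.single_apply]
  have h := hind.mgf_sum (fun k => hLm.comp (hstep k)) (Finset.range n) (t := 1)
  rw [Finset.prod_congr rfl fun k _ => hmgf k, Finset.prod_const, Finset.card_range] at h
  rw [← h, mgf]
  refine integral_congr_ae ?_
  filter_upwards [hW.start] with ω hω
  rw [one_mul, Finset.sum_apply]
  have hsub : ∀ v w, L (v - w) = L v - L w := fun v w => by
    simp [hL, mul_sub]
  simp only [hsub]
  rw [Finset.sum_range_sub (fun k => L (W k ω)), hω]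
  simp [hL]

theorem stepMGF_pos (hd1 : 1 ≤ d) (t : Fin d → ℝ) : 0 < stepMGF d t := by
  have : NeZero d := ⟨by omega⟩
  exact div_pos (Finset.sum_pos (fun i _ => Real.cosh_pos _) Finset.univ_nonempty)
    (by exact_mod_cast hd1)

theorem IsSimpleRandomWalk.integrable_exp (hW : IsSimpleRandomWalk d P W) (hd1 : 1 ≤ d) (n : ℕ)
    (t : Fin d → ℝ) : Integrable (fun ω => Real.exp (∑ i, t i * W n ω i)) P := by
  -- A non-integrable function has Bochner integral 0, whereas this integral is a power of a
  -- positive number.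
  by_contra h
  have := hW.integral_exp hd1 n t
  rw [integral_undef h] at this
  exact (pow_pos (stepMGF_pos hd1 t) n).ne this

/-! ### The Gaussian smoothing identity. -/

theorem smoothedDensity_eq (hd1 : 1 ≤ d) {n : ℕ} (hn : 1 ≤ n) (x : Fin d → ℝ) :
    smoothedDensity d n x = Real.exp (-(((n : ℝ) ^ (1 / 4 : ℝ)) ^ 2 / (2 * d) * ∑ i, x i ^ 2)) *
      stepMGF d (fun i => x i / (n : ℝ) ^ (1 / 4 : ℝ)) ^ n := by
  have hd : (0 : ℝ) < d := by exact_mod_cast hd1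
  have hr := one_le_rpow_quarter hn
  have hr4 := rpow_quarter_pow_four n
  rw [smoothedDensity, normalizedMGF, mul_pow, ← Real.exp_nat_mul, sum_sq_div, mul_comm]
  set r := (n : ℝ) ^ (1 / 4 : ℝ)
  rw [← hr4]
  congr 2
  field_simp

theorem IsSimpleRandomWalk.integral_smoothedDensity_mul_cexp (hW : IsSimpleRandomWalk d P W)
    (hd1 : 1 ≤ d) (hd3 : d ≤ 3) {n : ℕ} (hn : 1 ≤ n) (s : Fin d → ℝ) :
    ∫ x : Fin d → ℝ, (smoothedDensity d n x : ℂ) * Complex.exp ((∑ i, x i * s i : ℝ) * Complex.I) =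
      (Real.pi / (((n : ℝ) ^ (1 / 4 : ℝ)) ^ 2 / (2 * d) : ℝ) : ℂ) ^ ((d : ℂ) / 2) *
        Complex.exp (-(d * (∑ i, s i ^ 2) / (2 * ((n : ℝ) ^ (1 / 4 : ℝ)) ^ 2) : ℝ)) *
        ∫ ω, (Real.exp (d * (∑ i, (W n ω i : ℝ) ^ 2) / (2 * n)) : ℂ) *
          Complex.exp ((d / ((n : ℝ) ^ (1 / 4 : ℝ)) ^ 3 * ∑ i, (W n ω i : ℝ) * s i : ℝ) *
            Complex.I) ∂P := by
  have hd : (0 : ℝ) < d := by exact_mod_cast hd1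
  have hr := one_le_rpow_quarter hn
  have hr4 := rpow_quarter_pow_four n
  have hg := smoothedDensity_eq hd1 hn
  have hgi := integrable_smoothedDensity hd1 hd3 hn
  set r := (n : ℝ) ^ (1 / 4 : ℝ)
  have hr0 : 0 < r := by linarith
  set b : ℝ := r ^ 2 / (2 * d) with hb
  have hb0 : 0 < b := by positivity
  have hWm := hW.measurable n
  have hWi : ∀ i, Measurable fun ω => (W n ω i : ℝ) := fun i =>
    (measurable_of_countable (fun w : Fin d → ℤ => (w i : ℝ))).comp hWm
  -- Fubini for `F`: integrating over `ω` first gives the smoothed density, integrating over `x`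
  -- first gives the tilted walk.
  set F : (Fin d → ℝ) → Ω → ℂ := fun x ω => Complex.exp ((-(b * ∑ i, x i ^ 2) : ℝ)) *
    Complex.exp ((∑ i, x i * s i : ℝ) * Complex.I) *
    (Real.exp (∑ i, x i / r * W n ω i) : ℂ) with hF
  have hFint : ∀ x, ∫ ω, F x ω ∂P =
      (smoothedDensity d n x : ℂ) * Complex.exp ((∑ i, x i * s i : ℝ) * Complex.I) := fun x => by
    rw [hF, integral_const_mul, integral_complex_ofReal,
      hW.integral_exp hd1 n (fun i => x i / r), hg]
    push_cast
    ring
  have hFnorm : ∀ x ω, ‖F x ω‖ = Real.exp (-(b * ∑ i, x i ^ 2)) *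
      Real.exp (∑ i, x i / r * W n ω i) := fun x ω => by
    rw [hF, norm_mul, norm_mul, Complex.norm_exp_ofReal_mul_I, mul_one, Complex.norm_exp_ofReal,
      Complex.norm_real, Real.norm_of_nonneg (Real.exp_pos _).le]
  have hFprod : Integrable (Function.uncurry F) (volume.prod P) := by
    have hm : Measurable (Function.uncurry F) := by
      have h1 : ∀ i, Measurable fun z : (Fin d → ℝ) × Ω => (W n z.2 i : ℝ) := fun i =>
        (hWi i).comp measurable_snd
      have h2 : ∀ i, Measurable fun z : (Fin d → ℝ) × Ω => z.1 i := fun i =>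
        (measurable_pi_apply i).comp measurable_fst
      simp only [hF, Function.uncurry_def]
      fun_prop
    rw [integrable_prod_iff hm.aestronglyMeasurable]
    refine ⟨ae_of_all _ fun x => ?_, ?_⟩
    · simp only [Function.uncurry_apply_pair, hF]
      exact ((hW.integrable_exp hd1 n fun i => x i / r).ofReal (𝕜 := ℂ)).const_mul _
    · refine hgi.congr (ae_of_all _ fun x => ?_)
      simp only [Function.uncurry_apply_pair, hFnorm]
      rw [integral_const_mul, hW.integral_exp hd1 n (fun i => x i / r), hg]
  simp only [← hFint]
  rw [integral_integral_swap hFprod, ← integral_const_mul]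
  refine integral_congr_ae (ae_of_all _ fun ω => ?_)
  -- With linear coefficient `c = W_n / r + i s`, the exponent `∑ c_j² / (4b)` splits into the tilt,
  -- the phase `d W_n · s / r^3`, and the Gaussian damping in `s`.
  have hgauss := GaussianFourier.integral_cexp_neg_mul_sum_add (ι := Fin d) (b := (b : ℂ))
    (by simpa using hb0) (fun i => (W n ω i / r : ℂ) + s i * Complex.I)
  have e : (fun x => F x ω) = fun x : Fin d → ℝ => Complex.exp (-(b : ℂ) * ∑ i, (x i : ℂ) ^ 2 +
      ∑ i, ((W n ω i / r : ℂ) + s i * Complex.I) * x i) := by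
    funext x
    simp only [hF]
    rw [Complex.ofReal_exp, ← Complex.exp_add, ← Complex.exp_add]
    congr 1
    push_cast
    rw [neg_mul, add_assoc, Finset.sum_mul, ← Finset.sum_add_distrib]
    congr 2
    funext i
    ring
  simp only [e, hgauss, Fintype.card_fin]
  rw [mul_assoc, Complex.ofReal_exp, ← Complex.exp_add, ← Complex.exp_add]
  congr 2
  rw [hb, ← hr4]
  have hdC : (d : ℂ) ≠ 0 := by exact_mod_cast hd.ne'
  have hrC : (r : ℂ) ≠ 0 := by exact_mod_cast hr0.ne'
  have hI : ∀ i, ((W n ω i / r : ℂ) + s i * Complex.I) ^ 2 =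
      (W n ω i : ℂ) ^ 2 / r ^ 2 + 2 * Complex.I / r * (W n ω i * s i) - s i ^ 2 := fun i => by
    rw [add_sq, mul_pow _ Complex.I, Complex.I_sq, div_pow]
    ring
  simp only [hI, Finset.sum_add_distrib, Finset.sum_sub_distrib, ← Finset.mul_sum, ← Finset.sum_div]
  push_cast
  field_simp
  ring

end Walk

/-! ### The limit law and its characteristic function. -/

theorem limitPsi_eq {d : ℕ} (hd1 : 1 ≤ d) (hd3 : d ≤ 3) (x : EuclideanSpace ℝ (Fin d)) :
    limitPsi d x = Real.exp (-quarticForm d x.ofLp) := by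
  interval_cases d
  · rw [quarticForm_one]; rfl
  · rw [quarticForm_two]; rfl
  · rw [quarticForm_three]; rfl

theorem integral_comp_ofLp {d : ℕ} {E : Type*} [NormedAddCommGroup E] [NormedSpace ℝ E]
    (f : (Fin d → ℝ) → E) : ∫ x : EuclideanSpace ℝ (Fin d), f x.ofLp = ∫ x, f x :=
  (EuclideanSpace.volume_preserving_symm_measurableEquiv_toLp (Fin d)).integral_comp'
    (f := (MeasurableEquiv.toLp 2 (Fin d → ℝ)).symm) f

theorem integrable_exp_neg_quarticForm {d : ℕ} (hd1 : 1 ≤ d) (hd3 : d ≤ 3) :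
    Integrable (fun x : Fin d → ℝ => Real.exp (-quarticForm d x)) := by
  simpa using integrable_exp_neg_mul_quarticForm hd1 hd3 one_pos

theorem measurable_limitPsi {d : ℕ} (hd1 : 1 ≤ d) (hd3 : d ≤ 3) : Measurable (limitPsi d) := by
  simp only [funext (limitPsi_eq hd1 hd3)]
  exact ((measurable_quarticForm d).comp (by fun_prop)).neg.exp

theorem integrable_limitPsi {d : ℕ} (hd1 : 1 ≤ d) (hd3 : d ≤ 3) : Integrable (limitPsi d) := by
  rw [funext (limitPsi_eq hd1 hd3)]
  exact (PiLp.volume_preserving_ofLp (Fin d)).integrable_comp_of_integrable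
    (integrable_exp_neg_quarticForm hd1 hd3)

theorem integral_limitPsi {d : ℕ} (hd1 : 1 ≤ d) (hd3 : d ≤ 3) :
    ∫ x, limitPsi d x = ∫ x : Fin d → ℝ, Real.exp (-quarticForm d x) := by
  rw [funext (limitPsi_eq hd1 hd3)]
  exact integral_comp_ofLp fun x => Real.exp (-quarticForm d x)

theorem integral_exp_neg_quarticForm_pos {d : ℕ} (hd1 : 1 ≤ d) (hd3 : d ≤ 3) :
    0 < ∫ x : Fin d → ℝ, Real.exp (-quarticForm d x) :=
  integral_exp_pos (integrable_exp_neg_quarticForm hd1 hd3)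

theorem limitPsi_div_nonneg {d : ℕ} (hd1 : 1 ≤ d) (hd3 : d ≤ 3) (x : EuclideanSpace ℝ (Fin d)) :
    0 ≤ limitPsi d x / ∫ y, limitPsi d y := by
  rw [integral_limitPsi hd1 hd3, limitPsi_eq hd1 hd3]
  exact div_nonneg (Real.exp_pos _).le (integral_exp_neg_quarticForm_pos hd1 hd3).le

theorem isProbabilityMeasure_limitLaw {d : ℕ} (hd1 : 1 ≤ d) (hd3 : d ≤ 3) :
    IsProbabilityMeasure (limitLaw d) := by
  constructor
  rw [limitLaw, withDensity_apply _ MeasurableSet.univ, Measure.restrict_univ,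
    ← ofReal_integral_eq_lintegral_ofReal ((integrable_limitPsi hd1 hd3).div_const _)
      (ae_of_all _ (limitPsi_div_nonneg hd1 hd3)), integral_div, integral_limitPsi hd1 hd3,
    div_self (integral_exp_neg_quarticForm_pos hd1 hd3).ne', ENNReal.ofReal_one]

theorem charFun_limitLaw {d : ℕ} (hd1 : 1 ≤ d) (hd3 : d ≤ 3) (s : EuclideanSpace ℝ (Fin d)) :
    charFun (limitLaw d) s = (∫ x : Fin d → ℝ, (Real.exp (-quarticForm d x) : ℂ) *
      Complex.exp ((∑ i, x i * s i : ℝ) * Complex.I)) /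
      (∫ x : Fin d → ℝ, Real.exp (-quarticForm d x) : ℝ) := by
  rw [charFun_apply, limitLaw, integral_withDensity_eq_integral_toReal_smul
    ((measurable_limitPsi hd1 hd3).div_const _).ennreal_ofReal
    (ae_of_all _ fun _ => ENNReal.ofReal_lt_top), ← integral_div, ← integral_comp_ofLp]
  refine integral_congr_ae (ae_of_all _ fun x => ?_)
  simp only [ENNReal.toReal_ofReal (limitPsi_div_nonneg hd1 hd3 x)]
  rw [integral_limitPsi hd1 hd3, limitPsi_eq hd1 hd3, Complex.real_smul, Complex.ofReal_div,
    PiLp.inner_apply, div_mul_eq_mul_div]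
  simp only [RCLike.inner_apply, conj_trivial, mul_comm]

/-! ### Characteristic functions of the rescaled tilted walk and the conclusion. -/

theorem norm_latticePoint_sq {d : ℕ} (w : Fin d → ℤ) :
    ‖latticePoint d w‖ ^ 2 = ∑ i, (w i : ℝ) ^ 2 := by
  simp [EuclideanSpace.norm_sq_eq, latticePoint]

theorem integral_changedLaw {Ω : Type*} [MeasurableSpace Ω] {P : Measure Ω} {d n : ℕ}
    {W : Ω → Fin d → ℤ} (hW : Measurable W) (F : (Fin d → ℤ) → ℂ) :
    ∫ w, F w ∂(changedLaw d n (P.map W)) =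
      (∫ ω, (Real.exp (d * (∑ i, (W ω i : ℝ) ^ 2) / (2 * n)) : ℂ) * F (W ω) ∂P) /
        (∫ ω, Real.exp (d * (∑ i, (W ω i : ℝ) ^ 2) / (2 * n)) ∂P : ℝ) := by
  rw [changedLaw, integral_tilted, integral_map hW.aemeasurable
    (measurable_of_countable _).aestronglyMeasurable, integral_map hW.aemeasurable
    (measurable_of_countable _).aestronglyMeasurable, ← integral_div]
  refine integral_congr_ae (ae_of_all _ fun ω => ?_)
  simp only [norm_latticePoint_sq]
  rw [Complex.real_smul, Complex.ofReal_div, div_mul_eq_mul_div]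

theorem rpow_three_quarters (n : ℕ) : (n : ℝ) ^ (3 / 4 : ℝ) = ((n : ℝ) ^ (1 / 4 : ℝ)) ^ 3 := by
  rw [← Real.rpow_natCast, ← Real.rpow_mul (Nat.cast_nonneg n)]
  norm_num

theorem measurable_smul_latticePoint {d : ℕ} (c : ℝ) :
    Measurable fun w => c • latticePoint d w := measurable_of_countable _

/-- A quotient of the smoothing identity at `s` and at `0`: the value at `0` supplies the
normalisation of the tilt, the power of `π / b` cancels, and the leading exponential undoes the
smoothing. -/
theorem charFun_map_smul_latticePoint {Ω Ω' : Type*} [MeasurableSpace Ω] [MeasurableSpace Ω']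
    {d : ℕ} (hd1 : 1 ≤ d) (hd3 : d ≤ 3) {P : Measure Ω} [IsProbabilityMeasure P]
    {W : ℕ → Ω → Fin d → ℤ} (hW : IsSimpleRandomWalk d P W) {n : ℕ} (hn : 1 ≤ n)
    {Q : Measure Ω'} {V : Ω' → Fin d → ℤ}
    (hV : HasLaw V (changedLaw d n (P.map (W n))) Q) (s : EuclideanSpace ℝ (Fin d)) :
    charFun (Q.map fun ω => ((d : ℝ) / (n : ℝ) ^ (3 / 4 : ℝ)) • latticePoint d (V ω)) s =
      (Real.exp (d * (∑ i, s i ^ 2) / (2 * ((n : ℝ) ^ (1 / 4 : ℝ)) ^ 2)) : ℂ) *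
        (∫ x : Fin d → ℝ, (smoothedDensity d n x : ℂ) *
          Complex.exp ((∑ i, x i * s i : ℝ) * Complex.I)) /
        (∫ x : Fin d → ℝ, (smoothedDensity d n x : ℂ) *
          Complex.exp ((∑ i, x i * (0 : Fin d → ℝ) i : ℝ) * Complex.I)) := by
  have hd : (0 : ℝ) < d := by exact_mod_cast hd1
  have hr := one_le_rpow_quarter hn
  have hmap : ∀ c : ℝ, Q.map (fun ω => c • latticePoint d (V ω)) =
      (changedLaw d n (P.map (W n))).map fun w => c • latticePoint d w := fun c => by
    rw [← hV.map_eq, AEMeasurable.map_map_of_aemeasurable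
      (measurable_smul_latticePoint c).aemeasurable hV.aemeasurable]
    rfl
  rw [hW.integral_smoothedDensity_mul_cexp hd1 hd3 hn s.ofLp,
    hW.integral_smoothedDensity_mul_cexp hd1 hd3 hn 0, rpow_three_quarters, charFun_apply, hmap,
    integral_map (measurable_smul_latticePoint _).aemeasurable
      (Measurable.aestronglyMeasurable (by fun_prop)), integral_changedLaw (hW.measurable n)]
  set r := (n : ℝ) ^ (1 / 4 : ℝ)
  have hr0 : 0 < r := by linarith
  have hK : (Real.pi / (r ^ 2 / (2 * d) : ℝ) : ℂ) ^ ((d : ℂ) / 2) ≠ 0 := by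
    rw [Complex.cpow_ne_zero_iff]
    left
    exact div_ne_zero (by exact_mod_cast Real.pi_ne_zero) (by exact_mod_cast (by positivity))
  have hinner : ∀ w, (inner ℝ ((d / r ^ 3) • latticePoint d w) s : ℝ) =
      d / r ^ 3 * ∑ i, (w i : ℝ) * s i := fun w => by
    rw [real_inner_smul_left, PiLp.inner_apply]
    simp only [RCLike.inner_apply, conj_trivial, latticePoint, mul_comm]
  simp only [hinner, Pi.zero_apply, mul_zero, Finset.sum_const_zero, Complex.ofReal_zero, zero_mul,
    Complex.exp_zero, mul_one, integral_complex_ofReal, ne_eq, OfNat.ofNat_ne_zero,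
    not_false_eq_true, zero_pow, zero_div, neg_zero]
  rw [mul_assoc _ (Complex.exp _), mul_left_comm, mul_div_mul_left _ _ hK, Complex.ofReal_exp,
    ← mul_assoc, ← Complex.exp_add, add_neg_cancel, Complex.exp_zero, one_mul]

theorem tendsto_charFun_map_smul_latticePoint {Ω : Type*} [MeasurableSpace Ω]
    {Ω' : ℕ → Type*} [∀ n, MeasurableSpace (Ω' n)]
    {d : ℕ} (hd1 : 1 ≤ d) (hd3 : d ≤ 3) {P : Measure Ω} [IsProbabilityMeasure P]
    {W : ℕ → Ω → Fin d → ℤ} (hW : IsSimpleRandomWalk d P W)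
    {Q : (n : ℕ) → Measure (Ω' n)} {V : (n : ℕ) → Ω' n → Fin d → ℤ}
    (hV : ∀ n, HasLaw (V n) (changedLaw d n (P.map (W n))) (Q n))
    (s : EuclideanSpace ℝ (Fin d)) :
    Tendsto (fun n : ℕ => charFun ((Q n).map fun ω =>
      ((d : ℝ) / (n : ℝ) ^ (3 / 4 : ℝ)) • latticePoint d (V n ω)) s) atTop
      (nhds (charFun (limitLaw d) s)) := by
  have hexp : Tendsto (fun n : ℕ => (Real.exp (d * (∑ i, s i ^ 2) /
      (2 * ((n : ℝ) ^ (1 / 4 : ℝ)) ^ 2)) : ℂ)) atTop (nhds 1) := by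
    have h := (tendsto_const_nhds (x := d * ∑ i, s i ^ 2)).div_atTop
      (((tendsto_pow_atTop two_ne_zero).comp tendsto_rpow_quarter).const_mul_atTop
        (two_pos (α := ℝ)))
    have h' := (Complex.continuous_ofReal.tendsto _).comp ((Real.continuous_exp.tendsto _).comp h)
    rwa [Real.exp_zero, Complex.ofReal_one] at h'
  have hZ := tendsto_integral_smoothedDensity_mul_cexp hd1 hd3 (0 : Fin d → ℝ)
  have eZ : (∫ x : Fin d → ℝ, (Real.exp (-quarticForm d x) : ℂ) *
      Complex.exp ((∑ i, x i * (0 : Fin d → ℝ) i : ℝ) * Complex.I)) =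
      (∫ x : Fin d → ℝ, Real.exp (-quarticForm d x) : ℝ) := by
    rw [← integral_complex_ofReal]
    simp
  rw [eZ] at hZ
  have hlim := (hexp.mul (tendsto_integral_smoothedDensity_mul_cexp hd1 hd3 s.ofLp)).div hZ
    (by exact_mod_cast (integral_exp_neg_quarticForm_pos hd1 hd3).ne')
  rw [one_mul, ← charFun_limitLaw hd1 hd3] at hlim
  refine hlim.congr' ?_
  filter_upwards [eventually_ge_atTop 1] with n hn
  exact (charFun_map_smul_latticePoint hd1 hd3 hW hn (hV n) s).symm

theorem mainTheorem9 (d : ℕ) (hd1 : 1 ≤ d) (hd3 : d ≤ 3)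
    {Ω : Type*} [MeasurableSpace Ω] (P : Measure Ω) [IsProbabilityMeasure P]
    (W : ℕ → Ω → Fin d → ℤ) (hW : IsSimpleRandomWalk d P W)
    {Ω' : ℕ → Type*} [∀ n, MeasurableSpace (Ω' n)]
    (Q : (n : ℕ) → Measure (Ω' n)) [∀ n, IsProbabilityMeasure (Q n)]
    (V : (n : ℕ) → Ω' n → Fin d → ℤ)
    (hV : ∀ n, HasLaw (V n) (changedLaw d n (P.map (W n))) (Q n)) :
    Integrable (limitPsi d) volume ∧
    ∃ _ : IsProbabilityMeasure (limitLaw d),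
      TendstoInDistribution
        (fun (n : ℕ) ω => ((d : ℝ) / (n : ℝ) ^ (3 / 4 : ℝ)) • latticePoint d (V n ω))
        atTop id Q (limitLaw d) := by
  have hprob := isProbabilityMeasure_limitLaw hd1 hd3
  refine ⟨integrable_limitPsi hd1 hd3, hprob, ⟨fun n =>
    (measurable_smul_latticePoint _).comp_aemeasurable (hV n).aemeasurable, aemeasurable_id, ?_⟩⟩
  refine ProbabilityMeasure.tendsto_of_tendsto_charFun fun s => ?_
  have h := tendsto_charFun_map_smul_latticePoint hd1 hd3 hW hV s
  simpa only [ProbabilityMeasure.coe_mk, Measure.map_id] using h
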